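/- Let $N>2$. For $\tau\in\mathbb H$ put $E_\tau=\mathbb C/\langle 1,\tau\rangle$, with coordinate $z$. Let $\widetilde T(N)$ be the set of isomorphism classes $[E,(p,q),\eta]$, where $E=\mathbb C/\Lambda$ is an elliptic curve, $(p,q)$ is a full level $N$ structure on $E$ with Weil pairing $\langle p,q\rangle=e^{2\pi i/N}$, and $\eta\in H^0(E,\omega_E)^*$ (possibly $\eta=0$). It is the part away from the cusps of the total space $T(N)$ of the dual of the Hodge bundle over the modular curve $X(N)$; its zero section $Z$ is the locus $\eta=0$. The map $\psi(\tau,t)=[E_\tau,(\tau/N,1/N),t\,dz^*]$ identifies $\widetilde T(N)$ with the complex manifold $(\mathbb H\times\mathbb C)/\Gamma(N)$, where $\begin{pmatrix}a&b\\c&d\end{pmatrix}(\tau,t)=\left(\frac{a\tau+b}{c\tau+d},\frac{t}{c\tau+d}\right)$. The group $\mathrm{SL}_2(\mathbb Z)$ acts on $\widetilde T(N)$ by $\begin{pmatrix}a&b\\c&d\end{pmatrix}[E,(p,q),\eta]=[E,(ap+bq,cp+dq),\eta]$. Suppose that $\alpha=\psi(\sigma,t_0)=[E_\sigma,(\sigma/N,1/N),t_0\,dz^*]\in\widetilde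 T(N)$ is fixed by $A\in\mathrm{SL}_2(\mathbb Z)$. Then: (i) If $A\notin\Gamma(N)$ (that is, if $A$ does not act trivially on $\widetilde T(N)$), then $t_0=0$, so $\alpha\in Z$. (ii) There is $\gamma\in\Gamma(N)$ such that $\gamma^{-1}A=\begin{pmatrix}a&b\\c&d\end{pmatrix}$ fixes $\sigma$ in $\mathbb H$ (with $\gamma=1$ if $A\sigma=\sigma$), and for $\lambda=c\sigma+d$ multiplication by $\lambda$ induces an automorphism of $E_\sigma$. The differential of $\psi$ at $(\sigma,t_0)$ is an isomorphism from $\mathbb C^2$ onto the tangent space $\mathcal T_\alpha$ of $T(N)$ at $\alpha$; in the resulting coordinates $(x,t)$ on $\mathcal T_\alpha$ ($x$ for the direction of $\tau$, along $Z$, and $t$ for the direction of the fibre), the action of $A$ on $\mathcal T_\alpha$, that is the differential at $\alpha$ of the holomorphic map $\beta\mapsto A\beta$, is $$A(x,t)=\left(\frac{x}{\lambda^2},\frac{t}{\lambda}\right).$$ -/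

import Mathlib

open scoped MatrixGroups UpperHalfPlane Manifold ContDiff

noncomputable section

namespace FramedCurve

/-- The subgroup `ℤ ω₁ + ℤ ω₂` of `ℂ`. -/
def periodLattice (ω₁ ω₂ : ℂ) : AddSubgroup ℂ := AddSubgroup.closure {ω₁, ω₂}

/-- `(ω₁, ω₂)` is a positively oriented `ℤ`-basis of the lattice `Λ ⊂ ℂ`
(positivity of `Im (ω₁ / ω₂)` contains the linear independence over `ℝ`). -/
def IsOrientedBasis (Λ : AddSubgroup ℂ) (ω₁ ω₂ : ℂ) : Prop :=
  0 < (ω₁ / ω₂).im ∧ Λ = periodLattice ω₁ ω₂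

/-- `p` and `q` are `N`-torsion points of `ℂ / Λ` whose Weil pairing `e_N(p, q)` is `ζ`:
for a positively oriented basis `(ω₁, ω₂)` of `Λ`, the pairing of `(a ω₁ + b ω₂) / N` with
`(c ω₁ + d ω₂) / N` is `exp (2 π i (a d - b c) / N)`. -/
def HasWeilPairing (N : ℕ) (Λ : AddSubgroup ℂ) (p q : ℂ ⧸ Λ) (ζ : ℂ) : Prop :=
  ∃ ω₁ ω₂ : ℂ, IsOrientedBasis Λ ω₁ ω₂ ∧ ∃ a b c d : ℤ,
    p = QuotientAddGroup.mk ((a * ω₁ + b * ω₂) / N) ∧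
    q = QuotientAddGroup.mk ((c * ω₁ + d * ω₂) / N) ∧
    ζ = Complex.exp (2 * Real.pi * Complex.I * ((a * d - b * c : ℤ) : ℂ) / N)

/-- Triples `(E, (p, q), η)`: an elliptic curve `E = ℂ / Λ`, a full level `N` structure
`(p, q)` on `E` with Weil pairing `exp (2 π i / N)`, and a linear functional `η` on the space
`H⁰(E, ω_E) = ℂ dz` of holomorphic differentials.  The functional is `η = t dz*`, where `dz*` is
the basis dual to `dz`; it is recorded by its value `t` on `dz`, and it may be zero. -/
structure Datum (N : ℕ) where
  Λ : AddSubgroup ℂ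
  isLattice : ∃ ω₁ ω₂, IsOrientedBasis Λ ω₁ ω₂
  p : ℂ ⧸ Λ
  q : ℂ ⧸ Λ
  weil : HasWeilPairing N Λ p q (Complex.exp (2 * Real.pi * Complex.I / N))
  η : ℂ

/-- Isomorphism of triples: an isomorphism `ℂ / Λ → ℂ / Λ'` of elliptic curves, which is
induced by multiplication by some `μ ≠ 0`, carrying `(p, q)` to `(p', q')` and `η` to `η'`.
As the isomorphism pulls `dz` back to `μ dz`, it carries `t dz*` to `μ t dz*`. -/
def Datum.Iso {N : ℕ} (X Y : Datum N) : Prop :=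
  ∃ μ : ℂ, μ ≠ 0 ∧ ∃ f : (ℂ ⧸ X.Λ) ≃+ (ℂ ⧸ Y.Λ),
    (∀ z : ℂ, f (QuotientAddGroup.mk z) = QuotientAddGroup.mk (μ * z)) ∧
    f X.p = Y.p ∧ f X.q = Y.q ∧ Y.η = μ * X.η

instance setoid (N : ℕ) : Setoid (Datum N) where
  r := Datum.Iso
  iseqv :=
    { refl := fun X => ⟨1, one_ne_zero, AddEquiv.refl _, by simp⟩
      symm := by
        rintro X Y ⟨μ, hμ, f, hf, hp, hq, hη⟩
        refine ⟨μ⁻¹, inv_ne_zero hμ, f.symm, fun z => ?_, ?_, ?_, ?_⟩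
        · rw [AddEquiv.symm_apply_eq, hf, mul_inv_cancel_left₀ hμ]
        · rw [AddEquiv.symm_apply_eq, hp]
        · rw [AddEquiv.symm_apply_eq, hq]
        · rw [hη, inv_mul_cancel_left₀ hμ]
      trans := by
        rintro X Y Z ⟨μ, hμ, f, hf, hp, hq, hη⟩ ⟨ν, hν, g, hg, hp', hq', hη'⟩
        refine ⟨ν * μ, mul_ne_zero hν hμ, f.trans g, fun z => ?_, ?_, ?_, ?_⟩
        · rw [AddEquiv.trans_apply, hf, hg, mul_assoc]
        · rw [AddEquiv.trans_apply, hp, hp']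
        · rw [AddEquiv.trans_apply, hq, hq']
        · rw [hη', hη, mul_assoc] }

/-- The open part `T̃(N)` (the complement of the cusp fibres) of the total space `T(N)` of the
dual of the Hodge bundle on the modular curve `X(N)`: isomorphism classes `[E, (p, q), η]`. -/
def OpenT (N : ℕ) : Type := Quotient (setoid N)

/-- The zero section `Z` of `T(N)` (over the complement of the cusps): classes with `η = 0`. -/
def zeroSection (N : ℕ) : Set (OpenT N) :=
  {α | ∃ X : Datum N, X.η = 0 ∧ α = Quotient.mk (setoid N) X}

/-! ### The action of `SL(2, ℤ)` on level structures -/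

theorem hasWeilPairing_smul {N : ℕ} {Λ : AddSubgroup ℂ} {p q : ℂ ⧸ Λ} {ζ : ℂ}
    (h : HasWeilPairing N Λ p q ζ) (A : SL(2, ℤ)) :
    HasWeilPairing N Λ (A 0 0 • p + A 0 1 • q) (A 1 0 • p + A 1 1 • q) ζ := by
  obtain ⟨ω₁, ω₂, hb, a, b, c, d, rfl, rfl, rfl⟩ := h
  refine ⟨ω₁, ω₂, hb, A 0 0 * a + A 0 1 * c, A 0 0 * b + A 0 1 * d,
    A 1 0 * a + A 1 1 * c, A 1 0 * b + A 1 1 * d, ?_, ?_, ?_⟩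
  · rw [← QuotientAddGroup.mk_zsmul, ← QuotientAddGroup.mk_zsmul, ← QuotientAddGroup.mk_add]
    congr 1
    push_cast [zsmul_eq_mul]
    ring
  · rw [← QuotientAddGroup.mk_zsmul, ← QuotientAddGroup.mk_zsmul, ← QuotientAddGroup.mk_add]
    congr 1
    push_cast [zsmul_eq_mul]
    ring
  · have hdet := A.det_coe
    rw [Matrix.det_fin_two] at hdet
    congr 4
    linear_combination (b * c - a * d) * hdet

theorem zsmul_comb {G : Type*} [AddCommGroup G] (a b a' b' c' d' : ℤ) (p q : G) :
    (a * a' + b * c') • p + (a * b' + b * d') • q =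
      a • (a' • p + b' • q) + b • (c' • p + d' • q) := by
  module

/-- `A = (a b; c d)` sends `(E, (p, q), η)` to `(E, (a p + b q, c p + d q), η)`: it permutes the
level structures and does not change the functional. -/
def Datum.smul {N : ℕ} (A : SL(2, ℤ)) (X : Datum N) : Datum N where
  Λ := X.Λ
  isLattice := X.isLattice
  p := A 0 0 • X.p + A 0 1 • X.q
  q := A 1 0 • X.p + A 1 1 • X.q
  weil := hasWeilPairing_smul X.weil A
  η := X.η

instance (N : ℕ) : MulAction SL(2, ℤ) (Datum N) where
  smul := Datum.smul
  one_smul X := by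
    change Datum.smul 1 X = X
    cases X
    simp [Datum.smul]
  mul_smul A B X := by
    change Datum.smul (A * B) X = Datum.smul A (Datum.smul B X)
    cases X
    simp only [Datum.smul, Matrix.SpecialLinearGroup.coe_mul, Matrix.mul_apply, Fin.sum_univ_two]
    congr 1 <;> exact zsmul_comb _ _ _ _ _ _ _ _

/-- The action of `SL(2, ℤ)` on `T̃(N)`:
`A [E, (p, q), η] = [E, (a p + b q, c p + d q), η]`. -/
instance (N : ℕ) : MulAction SL(2, ℤ) (OpenT N) where
  smul A := Quotient.map (A • ·) (by
    rintro X Y ⟨μ, hμ, f, hf, hp, hq, hη⟩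
    refine ⟨μ, hμ, f, hf, ?_, ?_, hη⟩
    · change f (A 0 0 • X.p + A 0 1 • X.q) = A 0 0 • Y.p + A 0 1 • Y.q
      rw [map_add, map_zsmul, map_zsmul, hp, hq]
    · change f (A 1 0 • X.p + A 1 1 • X.q) = A 1 0 • Y.p + A 1 1 • Y.q
      rw [map_add, map_zsmul, map_zsmul, hp, hq])
  one_smul := by
    rintro ⟨X⟩
    exact congrArg (Quotient.mk (setoid N)) (one_smul _ X)
  mul_smul A B := by
    rintro ⟨X⟩
    exact congrArg (Quotient.mk (setoid N)) (mul_smul A B X)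

/-! ### The uniformization `ψ : ℍ × ℂ → T̃(N)` -/

/-- The lattice `ℤ τ + ℤ` of the elliptic curve `E_τ = ℂ / ⟨1, τ⟩`. -/
def tauLattice (τ : ℍ) : AddSubgroup ℂ := periodLattice τ 1

/-- The elliptic curve `E_τ = ℂ / ⟨1, τ⟩`. -/
abbrev EllCurve (τ : ℍ) : Type := ℂ ⧸ tauLattice τ

theorem isOrientedBasis_tau (τ : ℍ) : IsOrientedBasis (tauLattice τ) τ 1 :=
  ⟨by simpa using τ.im_pos, rfl⟩

/-- The triple `(E_τ, (τ / N, 1 / N), t dz*)`. -/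
def psiDatum (N : ℕ) (x : ℍ × ℂ) : Datum N where
  Λ := tauLattice x.1
  isLattice := ⟨_, _, isOrientedBasis_tau x.1⟩
  p := QuotientAddGroup.mk ((x.1 : ℂ) / N)
  q := QuotientAddGroup.mk (1 / N)
  weil := ⟨x.1, 1, isOrientedBasis_tau x.1, 1, 0, 0, 1, by simp, by simp, by simp⟩
  η := x.2

/-- `ψ(τ, t) = [E_τ, (τ / N, 1 / N), t dz*]`. -/
def psi (N : ℕ) (x : ℍ × ℂ) : OpenT N := Quotient.mk (setoid N) (psiDatum N x)

theorem mem_periodLattice {ω₁ ω₂ z : ℂ} :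
    z ∈ periodLattice ω₁ ω₂ ↔ ∃ m n : ℤ, m * ω₁ + n * ω₂ = z := by
  simp [periodLattice, AddSubgroup.mem_closure_pair]

/-- Multiplication by `μ` as an isomorphism of complex tori. -/
theorem exists_torusEquiv {Λ Λ' : AddSubgroup ℂ} (μ : ℂ) (hμ : μ ≠ 0)
    (h : ∀ z, z ∈ Λ ↔ μ * z ∈ Λ') :
    ∃ f : (ℂ ⧸ Λ) ≃+ (ℂ ⧸ Λ'), ∀ z : ℂ, f (QuotientAddGroup.mk z) =
      QuotientAddGroup.mk (μ * z) := by
  let e : ℂ ≃+ ℂ :=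
    { toFun := fun z => μ * z
      invFun := fun z => μ⁻¹ * z
      left_inv := fun z => inv_mul_cancel_left₀ hμ z
      right_inv := fun z => mul_inv_cancel_left₀ hμ z
      map_add' := fun z w => mul_add μ z w }
  refine ⟨QuotientAddGroup.congr Λ Λ' e ?_, fun z => rfl⟩
  ext w
  constructor
  · rintro ⟨z, hz, rfl⟩
    exact (h z).1 hz
  · intro hw
    exact ⟨μ⁻¹ * w, (h _).2 (by rwa [mul_inv_cancel_left₀ hμ]), mul_inv_cancel_left₀ hμ w⟩

theorem sl_coe_smul (A : SL(2, ℤ)) (τ : ℍ) :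
    ((A • τ : ℍ) : ℂ) = ((A 0 0 : ℂ) * τ + A 0 1) / ((A 1 0 : ℂ) * τ + A 1 1) := by
  rw [UpperHalfPlane.coe_specialLinearGroup_apply]
  simp

theorem denom_ne (A : SL(2, ℤ)) (τ : ℍ) : (A 1 0 : ℂ) * τ + A 1 1 ≠ 0 := by
  have := UpperHalfPlane.denom_ne_zero (A : GL (Fin 2) ℝ) τ
  rwa [ModularGroup.denom_apply] at this

/-- `A (τ, t) = ((a τ + b) / (c τ + d), t / (c τ + d))`. -/
instance actHC : MulAction SL(2, ℤ) (ℍ × ℂ) where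
  smul A x := (A • x.1, x.2 / ((A 1 0 : ℂ) * x.1 + A 1 1))
  one_smul x := by
    change ((1 : SL(2, ℤ)) • x.1, _) = x
    simp
  mul_smul A B x := by
    change ((A * B) • x.1, _) = (A • (B • x.1), _)
    refine Prod.ext (mul_smul A B x.1) ?_
    have h1 := denom_ne B x.1
    have h2 := denom_ne A (B • x.1)
    have h3 : ((A * B) 1 0 : ℂ) * x.1 + (A * B) 1 1 =
        ((B 1 0 : ℂ) * x.1 + B 1 1) * ((A 1 0 : ℂ) * (B • x.1 : ℍ) + A 1 1) := by
      rw [sl_coe_smul, mul_add, mul_left_comm, mul_div_cancel₀ _ h1]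
      simp only [Matrix.SpecialLinearGroup.coe_mul, Matrix.mul_apply, Fin.sum_univ_two]
      push_cast
      ring
    change x.2 / (((A * B) 1 0 : ℂ) * x.1 + (A * B) 1 1) =
      x.2 / ((B 1 0 : ℂ) * x.1 + B 1 1) / ((A 1 0 : ℂ) * (B • x.1 : ℍ) + A 1 1)
    rw [div_div, h3]

theorem smul_HC (A : SL(2, ℤ)) (x : ℍ × ℂ) :
    A • x = (A • x.1, x.2 / ((A 1 0 : ℂ) * x.1 + A 1 1)) := rfl


theorem mem_tauLattice {τ : ℍ} {z : ℂ} :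
    z ∈ tauLattice τ ↔ ∃ m n : ℤ, m * (τ : ℂ) + n = z := by
  simp [tauLattice, mem_periodLattice]

theorem periodLattice_sl (A : SL(2, ℤ)) (ω₁ ω₂ z : ℂ) :
    z ∈ periodLattice (A 0 0 * ω₁ + A 0 1 * ω₂) (A 1 0 * ω₁ + A 1 1 * ω₂) ↔
      z ∈ periodLattice ω₁ ω₂ := by
  have hdet := A.det_coe
  rw [Matrix.det_fin_two] at hdet
  have hC : (A 0 0 : ℂ) * A 1 1 - A 0 1 * A 1 0 = 1 := by exact_mod_cast hdet
  rw [mem_periodLattice, mem_periodLattice]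
  constructor
  · rintro ⟨m, n, rfl⟩
    refine ⟨m * A 0 0 + n * A 1 0, m * A 0 1 + n * A 1 1, ?_⟩
    push_cast
    ring
  · rintro ⟨m, n, rfl⟩
    refine ⟨m * A 1 1 - n * A 1 0, n * A 0 0 - m * A 0 1, ?_⟩
    push_cast
    linear_combination (m * ω₁ + n * ω₂) * hC

/-- `A ψ(τ, t) = ψ(A (τ, t))`. -/
theorem smul_psi (N : ℕ) (A : SL(2, ℤ)) (x : ℍ × ℂ) : A • psi N x = psi N (A • x) := by
  refine (Quotient.sound (s := setoid N) (?_ : Datum.Iso (psiDatum N (A • x))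
    (A • psiDatum N x))).symm
  have hμ := denom_ne A x.1
  have hτ := sl_coe_smul A x.1
  obtain ⟨f, hf⟩ := exists_torusEquiv (Λ := tauLattice (A • x.1)) (Λ' := tauLattice x.1)
    ((A 1 0 : ℂ) * x.1 + A 1 1) hμ (by
      intro z
      have h := periodLattice_sl A x.1 1 (((A 1 0 : ℂ) * x.1 + A 1 1) * z)
      rw [tauLattice, tauLattice, ← h, mem_periodLattice, mem_periodLattice, hτ]
      refine exists_congr fun m => exists_congr fun n => ?_
      rw [← mul_right_inj' hμ]
      have : ((A 1 0 : ℂ) * x.1 + A 1 1) * (m * (((A 0 0 : ℂ) * x.1 + A 0 1) /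
          ((A 1 0 : ℂ) * x.1 + A 1 1)) + n * 1) =
          m * ((A 0 0 : ℂ) * x.1 + A 0 1 * 1) + n * ((A 1 0 : ℂ) * x.1 + A 1 1 * 1) := by
        rw [mul_add, mul_left_comm, mul_div_cancel₀ _ hμ]
        ring
      rw [this])
  refine ⟨_, hμ, f, hf, ?_, ?_, ?_⟩
  · refine (hf _).trans ?_
    change _ = A 0 0 • (QuotientAddGroup.mk _ : ℂ ⧸ tauLattice x.1) +
      A 0 1 • (QuotientAddGroup.mk _ : ℂ ⧸ tauLattice x.1)
    rw [← QuotientAddGroup.mk_zsmul, ← QuotientAddGroup.mk_zsmul, ← QuotientAddGroup.mk_add]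
    congr 1
    change _ * (((A • x.1 : ℍ) : ℂ) / N) = _
    rw [hτ, ← mul_div_assoc, mul_div_cancel₀ _ hμ]
    push_cast [zsmul_eq_mul]
    ring
  · refine (hf _).trans ?_
    change _ = A 1 0 • (QuotientAddGroup.mk _ : ℂ ⧸ tauLattice x.1) +
      A 1 1 • (QuotientAddGroup.mk _ : ℂ ⧸ tauLattice x.1)
    rw [← QuotientAddGroup.mk_zsmul, ← QuotientAddGroup.mk_zsmul, ← QuotientAddGroup.mk_add]
    congr 1
    push_cast [zsmul_eq_mul]
    ring
  · change x.2 = _ * (x.2 / _)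
    rw [mul_div_cancel₀ _ hμ]

theorem mem_Gamma_iff {N : ℕ} {A : SL(2, ℤ)} : A ∈ CongruenceSubgroup.Gamma N ↔
    ((N : ℤ) ∣ A 0 0 - 1 ∧ (N : ℤ) ∣ A 0 1) ∧ (N : ℤ) ∣ A 1 0 ∧ (N : ℤ) ∣ A 1 1 - 1 := by
  rw [CongruenceSubgroup.Gamma_mem, ← ZMod.intCast_zmod_eq_zero_iff_dvd,
    ← ZMod.intCast_zmod_eq_zero_iff_dvd, ← ZMod.intCast_zmod_eq_zero_iff_dvd,
    ← ZMod.intCast_zmod_eq_zero_iff_dvd]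
  push_cast
  rw [sub_eq_zero, sub_eq_zero, and_assoc]

theorem psi_gamma {N : ℕ} (hN : N ≠ 0) {A : SL(2, ℤ)} (hA : A ∈ CongruenceSubgroup.Gamma N)
    (x : ℍ × ℂ) : psi N (A • x) = psi N x := by
  have hN' : (N : ℂ) ≠ 0 := by exact_mod_cast hN
  rw [← smul_psi]
  obtain ⟨⟨⟨a, ha⟩, ⟨b, hb⟩⟩, ⟨c, hc⟩, ⟨d, hd⟩⟩ := mem_Gamma_iff.1 hA
  have ha' : (A 0 0 : ℂ) = 1 + N * a := by
    have : A 0 0 = 1 + N * a := by linarith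
    exact_mod_cast this
  have hb' : (A 0 1 : ℂ) = N * b := by exact_mod_cast hb
  have hc' : (A 1 0 : ℂ) = N * c := by exact_mod_cast hc
  have hd' : (A 1 1 : ℂ) = 1 + N * d := by
    have : A 1 1 = 1 + N * d := by linarith
    exact_mod_cast this
  refine Quotient.sound (s := setoid N) (?_ : Datum.Iso (A • psiDatum N x) (psiDatum N x))
  refine ⟨1, one_ne_zero, AddEquiv.refl _, fun z => ?_, ?_, ?_, (one_mul _).symm⟩
  · rw [one_mul]
    rfl
  · change A 0 0 • (QuotientAddGroup.mk _ : ℂ ⧸ tauLattice x.1) +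
      A 0 1 • (QuotientAddGroup.mk _ : ℂ ⧸ tauLattice x.1) = QuotientAddGroup.mk _
    rw [← QuotientAddGroup.mk_zsmul, ← QuotientAddGroup.mk_zsmul, ← QuotientAddGroup.mk_add,
      eq_comm, QuotientAddGroup.eq, mem_tauLattice]
    refine ⟨a, b, ?_⟩
    rw [zsmul_eq_mul, zsmul_eq_mul, ha', hb']
    field_simp
    ring
  · change A 1 0 • (QuotientAddGroup.mk _ : ℂ ⧸ tauLattice x.1) +
      A 1 1 • (QuotientAddGroup.mk _ : ℂ ⧸ tauLattice x.1) = QuotientAddGroup.mk _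
    rw [← QuotientAddGroup.mk_zsmul, ← QuotientAddGroup.mk_zsmul, ← QuotientAddGroup.mk_add,
      eq_comm, QuotientAddGroup.eq, mem_tauLattice]
    refine ⟨c, d, ?_⟩
    rw [zsmul_eq_mul, zsmul_eq_mul, hc', hd']
    field_simp
    ring

theorem tau_indep {τ : ℍ} {a b c d : ℤ} (h : (a : ℂ) * τ + b = c * τ + d) : a = c ∧ b = d := by
  have him := congrArg Complex.im h
  have hre := congrArg Complex.re h
  simp at him hre
  have h1 : a = c := by
    rcases him with h | h
    · exact h
    · exact absurd h τ.im_pos.ne'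
  subst h1
  exact ⟨rfl, by simpa using hre⟩

theorem psi_eq {N : ℕ} (hN : N ≠ 0) {x y : ℍ × ℂ} (h : psi N x = psi N y) :
    ∃ A ∈ CongruenceSubgroup.Gamma N, A • y = x := by
  have hN' : (N : ℂ) ≠ 0 := by exact_mod_cast hN
  obtain ⟨μ, hμ, f, hf, hp, hq, hη⟩ : Datum.Iso (psiDatum N x) (psiDatum N y) :=
    Quotient.exact (s := setoid N) h
  change y.2 = μ * x.2 at hη
  have hlat : ∀ z, z ∈ tauLattice x.1 ↔ μ * z ∈ tauLattice y.1 := by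
    intro z
    have h1 : (QuotientAddGroup.mk z : ℂ ⧸ tauLattice x.1) = 0 ↔
        (QuotientAddGroup.mk (μ * z) : ℂ ⧸ tauLattice y.1) = 0 := by
      have := hf z
      constructor
      · intro h0
        refine this.symm.trans ?_
        refine (congrArg f h0).trans (map_zero f)
      · intro h0
        exact (map_eq_zero_iff f f.injective).1 (this.trans h0)
    rwa [QuotientAddGroup.eq_zero_iff, QuotientAddGroup.eq_zero_iff] at h1
  have hp' : (QuotientAddGroup.mk ((y.1 : ℂ) / N) : ℂ ⧸ tauLattice y.1) =
      QuotientAddGroup.mk (μ * ((x.1 : ℂ) / N)) := hp.symm.trans (hf _)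
  have hq' : (QuotientAddGroup.mk (1 / N) : ℂ ⧸ tauLattice y.1) =
      QuotientAddGroup.mk (μ * (1 / N)) := hq.symm.trans (hf _)
  rw [QuotientAddGroup.eq, mem_tauLattice] at hp' hq'
  obtain ⟨a, b, hab⟩ := hp'
  obtain ⟨c, d, hcd⟩ := hq'
  have e1 : μ * x.1 = ((1 + N * a : ℤ) : ℂ) * y.1 + ((N * b : ℤ) : ℂ) := by
    push_cast
    have h3 : μ * (x.1 / N) = y.1 / N + (a * y.1 + b) := by rw [hab]; ring
    have : μ * x.1 = N * (μ * (x.1 / N)) := by field_simp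
    rw [this, h3]
    field_simp
    ring
  have e2 : μ = ((N * c : ℤ) : ℂ) * y.1 + ((1 + N * d : ℤ) : ℂ) := by
    push_cast
    have h3 : μ * (1 / N) = 1 / N + (c * y.1 + d) := by rw [hcd]; ring
    have : μ = N * (μ * (1 / N)) := by field_simp
    rw [this, h3]
    field_simp
    ring
  obtain ⟨a', ha'⟩ : ∃ a' : ℤ, a' = 1 + N * a := ⟨_, rfl⟩
  obtain ⟨b', hb'⟩ : ∃ b' : ℤ, b' = N * b := ⟨_, rfl⟩
  obtain ⟨c', hc'⟩ : ∃ c' : ℤ, c' = N * c := ⟨_, rfl⟩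
  obtain ⟨d', hd'⟩ : ∃ d' : ℤ, d' = 1 + N * d := ⟨_, rfl⟩
  rw [← ha', ← hb'] at e1
  rw [← hc', ← hd'] at e2
  have hy : (y.1 : ℂ) ∈ tauLattice y.1 := mem_tauLattice.2 ⟨1, 0, by simp⟩
  have h1 : (1 : ℂ) ∈ tauLattice y.1 := mem_tauLattice.2 ⟨0, 1, by simp⟩
  obtain ⟨m, n, hmn⟩ := mem_tauLattice.1
    ((hlat (μ⁻¹ * y.1)).2 (by rwa [mul_inv_cancel_left₀ hμ]))
  obtain ⟨m', n', hmn'⟩ := mem_tauLattice.1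
    ((hlat (μ⁻¹ * 1)).2 (by rwa [mul_inv_cancel_left₀ hμ]))
  have k1 : ((m * a' + n * c' : ℤ) : ℂ) * y.1 + ((m * b' + n * d' : ℤ) : ℂ) =
      ((1 : ℤ) : ℂ) * y.1 + ((0 : ℤ) : ℂ) := by
    have h2 : m * (μ * x.1) + n * μ = y.1 := by
      rw [← mul_inv_cancel_left₀ hμ (y.1 : ℂ), ← hmn]
      ring
    rw [e1] at h2
    rw [e2] at h2
    push_cast
    linear_combination h2
  have k2 : ((m' * a' + n' * c' : ℤ) : ℂ) * y.1 + ((m' * b' + n' * d' : ℤ) : ℂ) =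
      ((0 : ℤ) : ℂ) * y.1 + ((1 : ℤ) : ℂ) := by
    have h2 : m' * (μ * x.1) + n' * μ = 1 := by
      rw [← mul_inv_cancel_left₀ hμ (1 : ℂ), ← hmn']
      ring
    rw [e1] at h2
    rw [e2] at h2
    push_cast
    linear_combination h2
  obtain ⟨k1, k1'⟩ := tau_indep k1
  obtain ⟨k2, k2'⟩ := tau_indep k2
  have hunit : (a' * d' - b' * c') * (m * n' - n * m') = 1 := by
    linear_combination (m' * b' + n' * d') * k1 + k2' - (m' * a' + n' * c') * k1'
  have hpos : 0 < a' * d' - b' * c' := by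
    have him : ((a' * d' - b' * c' : ℤ) : ℝ) * y.1.im = x.1.im * Complex.normSq μ := by
      have h3 : (μ * x.1 * (starRingEnd ℂ) μ).im = x.1.im * Complex.normSq μ := by
        rw [mul_right_comm, Complex.mul_conj, Complex.im_ofReal_mul, mul_comm]
        rfl
      rw [← h3, e1, e2]
      simp
      ring
    have hr : 0 < ((a' * d' - b' * c' : ℤ) : ℝ) * y.1.im := by
      rw [him]
      exact mul_pos x.1.im_pos (Complex.normSq_pos.2 hμ)
    exact_mod_cast (pos_iff_pos_of_mul_pos hr).2 y.1.im_pos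
  have hdet : a' * d' - b' * c' = 1 := by
    rcases Int.eq_one_or_neg_one_of_mul_eq_one hunit with h | h
    · exact h
    · omega
  refine ⟨⟨!![a', b'; c', d'], by rw [Matrix.det_fin_two_of]; exact hdet⟩, ?_, ?_⟩
  · refine mem_Gamma_iff.2 ?_
    exact ⟨⟨⟨a, by simp [ha']⟩, ⟨b, by simp [hb']⟩⟩, ⟨c, by simp [hc']⟩, ⟨d, by simp [hd']⟩⟩
  · refine Prod.ext (UpperHalfPlane.ext ?_) ?_
    · refine (sl_coe_smul _ _).trans ?_
      change ((a' : ℂ) * y.1 + b') / ((c' : ℂ) * y.1 + d') = x.1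
      rw [← e1, ← e2, mul_div_cancel_left₀ _ hμ]
    · change y.2 / ((c' : ℂ) * y.1 + d') = x.2
      rw [← e2, hη, mul_div_cancel_left₀ _ hμ]

/-- `ψ(x) = ψ(y)` if and only if `x` and `y` are in the same `Γ(N)`-orbit. -/
theorem psi_eq_iff {N : ℕ} (hN : N ≠ 0) {x y : ℍ × ℂ} :
    psi N x = psi N y ↔ x ∈ MulAction.orbit (CongruenceSubgroup.Gamma N) y := by
  constructor
  · intro h
    obtain ⟨A, hA, rfl⟩ := psi_eq hN h
    exact ⟨⟨A, hA⟩, rfl⟩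
  · rintro ⟨⟨A, hA⟩, rfl⟩
    exact psi_gamma hN hA y

theorem exists_coprime_add_mul (c d : ℤ) (N : ℕ) (hc : c ≠ 0)
    (h : ∀ g : ℤ, g ∣ c → g ∣ d → g ∣ N → IsUnit g) : ∃ k : ℤ, IsCoprime c (d + k * N) := by
  classical
  let s : Finset ℕ := c.natAbs.primeFactors.filter fun p => ¬ (p : ℤ) ∣ d
  refine ⟨((∏ p ∈ s, p : ℕ) : ℤ), ?_⟩
  rw [Int.isCoprime_iff_gcd_eq_one]
  by_contra hg
  obtain ⟨p, hp, hpg⟩ := Nat.exists_prime_and_dvd hg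
  have hpc : (p : ℤ) ∣ c := (Int.natCast_dvd_natCast.2 hpg).trans (Int.gcd_dvd_left ..)
  have hpd : (p : ℤ) ∣ d + ((∏ p ∈ s, p : ℕ) : ℤ) * N :=
    (Int.natCast_dvd_natCast.2 hpg).trans (Int.gcd_dvd_right ..)
  by_cases hd : (p : ℤ) ∣ d
  · have h1 : (p : ℤ) ∣ ((∏ p ∈ s, p : ℕ) : ℤ) * N := (dvd_add_right hd).1 hpd
    rcases (Nat.prime_iff_prime_int.1 hp).dvd_or_dvd h1 with h2 | h2
    · rw [Int.natCast_dvd_natCast, hp.prime.dvd_finsetProd_iff] at h2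
      obtain ⟨q, hq, hpq⟩ := h2
      have hq' := Finset.mem_filter.1 hq
      have : p = q := (Nat.prime_dvd_prime_iff_eq hp (Nat.prime_of_mem_primeFactors hq'.1)).1 hpq
      exact hq'.2 (this ▸ hd)
    · exact (Nat.prime_iff_prime_int.1 hp).not_isUnit (h p hpc hd h2)
  · have hps : p ∈ s := Finset.mem_filter.2
      ⟨Nat.mem_primeFactors.2 ⟨hp, Int.natCast_dvd.1 hpc, Int.natAbs_ne_zero.2 hc⟩, hd⟩
    have h1 : (p : ℤ) ∣ ((∏ p ∈ s, p : ℕ) : ℤ) :=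
      Int.natCast_dvd_natCast.2 (Finset.dvd_prod_of_mem _ hps)
    exact hd ((dvd_add_left (h1.mul_right _)).1 hpd)

theorem exists_sl_lift {N : ℕ} (hN : N ≠ 0) {a b c d : ℤ} (h : (N : ℤ) ∣ a * d - b * c - 1) :
    ∃ A : SL(2, ℤ), ((N : ℤ) ∣ A 0 0 - a ∧ (N : ℤ) ∣ A 0 1 - b) ∧
      (N : ℤ) ∣ A 1 0 - c ∧ (N : ℤ) ∣ A 1 1 - d := by
  obtain ⟨e, he⟩ := h
  have hN' : (N : ℤ) ≠ 0 := by exact_mod_cast hN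
  obtain ⟨j, hj⟩ : ∃ j : ℤ, c + j * N ≠ 0 := by
    by_cases hc : c = 0
    · exact ⟨1, by simpa [hc] using hN⟩
    · exact ⟨0, by simpa using hc⟩
  obtain ⟨k, hk⟩ := exists_coprime_add_mul (c + j * N) d N hj (by
    rintro g ⟨x, hx⟩ ⟨y, hy⟩ ⟨z, hz⟩
    refine IsUnit.of_mul_eq_one (a * y - b * (x - j * z) - z * e) ?_
    have hc : c = g * x - j * (g * z) := by rw [← hz, ← hx]; ring
    rw [hc, hy, hz] at he
    linear_combination he)
  obtain ⟨u, v, huv⟩ := hk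
  obtain ⟨c', hc'⟩ : ∃ c', c' = c + j * N := ⟨_, rfl⟩
  obtain ⟨d', hd'⟩ : ∃ d', d' = d + k * N := ⟨_, rfl⟩
  rw [← hc', ← hd'] at huv
  -- a particular matrix with bottom row `(c', d')` has top row `(v, -u)`
  obtain ⟨l, hl⟩ : ∃ l, l = u * (a - v) + v * (b + u) := ⟨_, rfl⟩
  obtain ⟨r, hr⟩ : ∃ r, a * d' - b * c' - 1 = N * r := ⟨e + a * k - b * j, by
    rw [hc', hd']; linear_combination he⟩
  refine ⟨⟨!![v + l * c', -u + l * d'; c', d'], ?_⟩, ⟨⟨-v * r, ?_⟩, ⟨u * r, ?_⟩⟩,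
    ⟨j, ?_⟩, ⟨k, ?_⟩⟩
  · rw [Matrix.det_fin_two_of]
    linear_combination huv
  · change v + l * c' - a = _
    rw [hl]
    linear_combination a * huv - v * hr
  · change -u + l * d' - b = _
    rw [hl]
    linear_combination b * huv + u * hr
  · change c' - c = _
    rw [hc']; ring
  · change d' - d = _
    rw [hd']; ring

/-- Every class in `T̃(N)` is of the form `[E_τ, (τ / N, 1 / N), t dz*]`. -/
theorem psi_surjective {N : ℕ} (hN : N ≠ 0) : Function.Surjective (psi N) := by
  rintro ⟨⟨Λ, -, p, q, ⟨ω₁, ω₂, ⟨him, hΛ⟩, a, b, c, d, rfl, rfl, hζ⟩, η⟩⟩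
  have hN' : (N : ℂ) ≠ 0 := by exact_mod_cast hN
  have hdvd : (N : ℤ) ∣ a * d - b * c - 1 := by
    obtain ⟨n, hn⟩ := Complex.exp_eq_exp_iff_exists_int.1 hζ.symm
    refine ⟨n, ?_⟩
    have h2 : (2 * Real.pi * Complex.I : ℂ) ≠ 0 := Complex.two_pi_I_ne_zero
    have : ((a * d - b * c : ℤ) : ℂ) = 1 + n * N := by
      have h3 : (2 * Real.pi * Complex.I : ℂ) * ((a * d - b * c : ℤ) : ℂ) =
          (2 * Real.pi * Complex.I : ℂ) * (1 + n * N) := by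
        rw [div_eq_iff hN'] at hn
        rw [hn]
        field_simp
      exact mul_left_cancel₀ h2 h3
    have h4 : a * d - b * c = 1 + n * N := by exact_mod_cast this
    rw [h4]; ring
  obtain ⟨A, ⟨⟨a', ha⟩, ⟨b', hb⟩⟩, ⟨c', hc⟩, ⟨d', hd⟩⟩ := exists_sl_lift hN hdvd
  obtain ⟨u, hu⟩ : ∃ u : ℂ, u = A 0 0 * ω₁ + A 0 1 * ω₂ := ⟨_, rfl⟩
  obtain ⟨v, hv⟩ : ∃ v : ℂ, v = A 1 0 * ω₁ + A 1 1 * ω₂ := ⟨_, rfl⟩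
  have hω₂ : ω₂ ≠ 0 := by
    rintro rfl
    simp at him
  let τ₀ : ℍ := ⟨ω₁ / ω₂, him⟩
  have hvω : v = ω₂ * (A 1 0 * τ₀ + A 1 1) := by
    change v = ω₂ * (A 1 0 * (ω₁ / ω₂) + A 1 1)
    rw [hv]
    field_simp
  have huω : u = ω₂ * (A 0 0 * τ₀ + A 0 1) := by
    change u = ω₂ * (A 0 0 * (ω₁ / ω₂) + A 0 1)
    rw [hu]
    field_simp
  have hv0 : v ≠ 0 := by
    rw [hvω]
    exact mul_ne_zero hω₂ (denom_ne A τ₀)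
  have hτ : ((A • τ₀ : ℍ) : ℂ) = u / v := by
    rw [sl_coe_smul, huω, hvω, mul_div_mul_left _ _ hω₂]
  have ha' : (A 0 0 : ℂ) = a + N * a' := by
    have : A 0 0 = a + N * a' := by linarith
    exact_mod_cast this
  have hb' : (A 0 1 : ℂ) = b + N * b' := by
    have : A 0 1 = b + N * b' := by linarith
    exact_mod_cast this
  have hc' : (A 1 0 : ℂ) = c + N * c' := by
    have : A 1 0 = c + N * c' := by linarith
    exact_mod_cast this
  have hd' : (A 1 1 : ℂ) = d + N * d' := by
    have : A 1 1 = d + N * d' := by linarith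
    exact_mod_cast this
  obtain ⟨f, hf⟩ := exists_torusEquiv (Λ := tauLattice (A • τ₀)) (Λ' := Λ) v hv0 (by
    intro z
    have h := periodLattice_sl A ω₁ ω₂ (v * z)
    rw [hΛ, ← h, ← hu, ← hv, tauLattice, mem_periodLattice, mem_periodLattice, hτ]
    refine exists_congr fun m => exists_congr fun n => ?_
    rw [← mul_right_inj' hv0]
    have : v * (m * (u / v) + n * 1) = m * u + n * v := by field_simp
    rw [this])
  refine ⟨(A • τ₀, η / v), ?_⟩
  refine Quotient.sound (s := setoid N) ⟨v, hv0, f, hf, ?_, ?_, ?_⟩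
  · refine (hf _).trans ?_
    rw [eq_comm, QuotientAddGroup.eq, hΛ, mem_periodLattice]
    refine ⟨a', b', ?_⟩
    change _ = _ + v * (((A • τ₀ : ℍ) : ℂ) / N)
    rw [hτ, ← mul_div_assoc, mul_div_cancel₀ _ hv0, hu, ha', hb']
    field_simp
    ring
  · refine (hf _).trans ?_
    rw [eq_comm, QuotientAddGroup.eq, hΛ, mem_periodLattice]
    refine ⟨c', d', ?_⟩
    rw [mul_one_div, hv, hc', hd']
    field_simp
    ring
  · change η = v * (η / v)
    rw [mul_div_cancel₀ _ hv0]

/-! ### The complex structure -/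

instance : ContinuousConstSMul SL(2, ℤ) (ℍ × ℂ) where
  continuous_const_smul A := by
    have h1 : Continuous fun x : ℍ × ℂ => A • x.1 := by
      have : Continuous fun τ : ℍ => A • τ :=
        continuous_const_smul (A : GL (Fin 2) ℝ)
      exact this.comp continuous_fst
    have h2 : Continuous fun x : ℍ × ℂ => x.2 / ((A 1 0 : ℂ) * x.1 + A 1 1) := by
      refine continuous_snd.div ?_ fun x => denom_ne A x.1
      exact (continuous_const.mul (UpperHalfPlane.continuous_coe.comp continuous_fst)).add
        continuous_const
    exact h1.prodMk h2

instance (N : ℕ) : ContinuousConstSMul (CongruenceSubgroup.Gamma N) (ℍ × ℂ) where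
  continuous_const_smul A := continuous_const_smul (A : SL(2, ℤ))

instance : ProperlyDiscontinuousSMul SL(2, ℤ) (ℍ × ℂ) where
  finite_disjoint_inter_image {K L} hK hL := by
    have hfin := (Subgroup.properlyDiscontinuousSMul_iff
      (S := (Matrix.SpecialLinearGroup.mapGL ℝ : SL(2, ℤ) →* GL (Fin 2) ℝ).range)).1
      inferInstance (hK.image continuous_fst) (hL.image continuous_fst)
    refine (hfin.preimage (f := Matrix.SpecialLinearGroup.mapGL ℝ)
      (Matrix.SpecialLinearGroup.mapGL_injective.injOn)).subset ?_
    rintro A ⟨_, ⟨x, hx, rfl⟩, hL'⟩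
    refine ⟨⟨A, rfl⟩, (A • x).1, ?_, ⟨_, hL', rfl⟩⟩
    exact ⟨x.1, ⟨x, hx, rfl⟩, rfl⟩

/-- For `N > 2` the group `Γ(N)` acts freely on `ℍ`. -/
theorem gamma_free {N : ℕ} (hN : 2 < N) {A : SL(2, ℤ)} (hA : A ∈ CongruenceSubgroup.Gamma N)
    {τ : ℍ} (h : A • τ = τ) : A = 1 := by
  obtain ⟨⟨⟨a, ha⟩, ⟨b, hb⟩⟩, ⟨c, hc⟩, ⟨d, hd⟩⟩ := mem_Gamma_iff.1 hA
  have hdet := A.det_coe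
  rw [Matrix.det_fin_two] at hdet
  have hN' : (2 : ℤ) < N := by exact_mod_cast hN
  have h1 : (A 0 0 : ℂ) * τ + A 0 1 = τ * ((A 1 0 : ℂ) * τ + A 1 1) := by
    have := sl_coe_smul A τ
    rwa [h, eq_comm, div_eq_iff (denom_ne A τ)] at this
  have hy := τ.im_pos
  have him := congrArg Complex.im h1
  have hre := congrArg Complex.re h1
  simp at him hre
  have e1 : (A 0 0 : ℝ) - A 1 1 = 2 * τ.re * A 1 0 := by
    have : ((A 0 0 : ℝ) - A 1 1 - 2 * τ.re * A 1 0) * τ.im = 0 := by linear_combination him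
    rcases mul_eq_zero.1 this with h | h
    · linarith
    · exact absurd h hy.ne'
  by_cases hc0 : A 1 0 = 0
  · have e2 : A 0 0 = A 1 1 := by
      rw [hc0] at e1
      have : (A 0 0 : ℝ) = A 1 1 := by simpa [sub_eq_zero] using e1
      exact_mod_cast this
    have e3 : A 0 1 = 0 := by
      rw [hc0, e2] at hre
      have : (A 0 1 : ℝ) = 0 := by
        simp at hre
        linarith
      exact_mod_cast this
    rw [hc0, e2, e3] at hdet
    have hd1 : A 1 1 = 1 := by
      have hu : A 1 1 * A 1 1 = 1 := by linarith
      rcases Int.eq_one_or_neg_one_of_mul_eq_one hu with h | h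
      · exact h
      · have h2 : (N : ℤ) ∣ 2 := ⟨-d, by rw [h] at hd; linarith⟩
        have := Int.le_of_dvd (by norm_num) h2
        omega
    ext i j
    fin_cases i <;> fin_cases j
    · exact e2.trans hd1
    · exact e3
    · exact hc0
    · exact hd1
  · exfalso
    have htr : ((A 0 0 : ℝ) + A 1 1) ^ 2 < 4 := by
      have hdet' : (A 0 0 : ℝ) * A 1 1 - A 0 1 * A 1 0 = 1 := by exact_mod_cast hdet
      have hc1 : (A 1 0 : ℝ) ≠ 0 := by exact_mod_cast hc0
      have hpos : 0 < ((A 1 0 : ℝ) * τ.im) ^ 2 := by positivity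
      have e3 : (A 0 0 : ℝ) * τ.re + A 0 1 =
          A 1 0 * (τ.re * τ.re - τ.im * τ.im) + A 1 1 * τ.re := by linear_combination hre
      have e4 : ((A 0 0 : ℝ) + A 1 1) ^ 2 = 4 - 4 * ((A 1 0 : ℝ) * τ.im) ^ 2 := by
        linear_combination 4 * hdet' + ((A 0 0 : ℝ) - A 1 1 - 2 * τ.re * A 1 0) * e1 +
          4 * (A 1 0 : ℝ) * e3
      linarith
    have htr' : (A 0 0 + A 1 1) ^ 2 < 4 := by exact_mod_cast htr
    have hk : (a + d) = - N * (a * d - b * c) := by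
      have h00 : A 0 0 = 1 + N * a := by linarith
      have h11 : A 1 1 = 1 + N * d := by linarith
      rw [h00, h11, hb, hc] at hdet
      have : (N : ℤ) * (a + d) = N * (-N * (a * d - b * c)) := by linear_combination hdet
      exact mul_left_cancel₀ (by omega) this
    have ht : A 0 0 + A 1 1 = 2 - N * N * (a * d - b * c) := by
      linear_combination ha + hd + (N : ℤ) * hk
    obtain ⟨k, hk'⟩ : ∃ k, k = a * d - b * c := ⟨_, rfl⟩
    rw [← hk'] at ht
    rw [ht] at htr'
    have h9 : 9 ≤ (N : ℤ) * N := by nlinarith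
    have hlo : -2 < 2 - (N : ℤ) * N * k := by nlinarith
    have hhi : 2 - (N : ℤ) * N * k < 2 := by nlinarith
    rcases le_or_gt k 0 with h | h
    · nlinarith
    · nlinarith

instance (N : ℕ) [hN : Fact (2 < N)] :
    IsCancelSMul (CongruenceSubgroup.Gamma N) (ℍ × ℂ) where
  left_cancel' a b c h := MulAction.injective a h
  right_cancel' a b x h := by
    have h1 : (b⁻¹ * a) • x = x := by rw [mul_smul, h, inv_smul_smul]
    have h2 : ((b⁻¹ * a : CongruenceSubgroup.Gamma N) : SL(2, ℤ)) • x.1 = x.1 :=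
      congrArg Prod.fst h1
    have h3 := gamma_free hN.out (b⁻¹ * a).2 h2
    have h4 : b⁻¹ * a = 1 := Subtype.ext h3
    exact (inv_mul_eq_one.1 h4).symm

/-- `T̃(N)` carries the quotient topology for `ψ : ℍ × ℂ → T̃(N)`. -/
instance (N : ℕ) : TopologicalSpace (OpenT N) :=
  TopologicalSpace.coinduced (psi N) inferInstance

theorem psi_isLocalHomeomorph (N : ℕ) [hN : Fact (2 < N)] : IsLocalHomeomorph (psi N) := by
  have hN0 : N ≠ 0 := by have := hN.out; omega
  have hq : Topology.IsQuotientMap (psi N) := ⟨⟨rfl⟩, psi_surjective hN0⟩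
  exact (hq.isQuotientCoveringMap_of_properlyDiscontinuousSMul (G := CongruenceSubgroup.Gamma N)
    (psi_eq_iff hN0)).isCoveringMap.isLocalHomeomorph

/-- For `N > 2` the complex structure of `T̃(N)` is the one of `(ℍ × ℂ) / Γ(N)`: its charts are
the local inverses of `ψ` followed by the coordinates `(τ, t)` of `ℍ × ℂ`. -/
instance (N : ℕ) [hN : Fact (2 < N)] : ChartedSpace (ModelProd ℂ ℂ) (OpenT N) :=
  (psi_isLocalHomeomorph N).chartedSpace
    (psi_surjective (by have := hN.out; omega))

theorem psi_transition {N : ℕ} [hN : Fact (2 < N)] {u w : ℍ × ℂ}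
    (hw : psi N w ∈ ((psi_isLocalHomeomorph N).localInverseAt u).source) :
    ∃ A : SL(2, ℤ), ∀ᶠ v in nhds w,
      (psi_isLocalHomeomorph N).localInverseAt u (psi N v) = A • v := by
  have hN0 : N ≠ 0 := by have := hN.out; omega
  obtain ⟨A, hA, hAw⟩ := psi_eq hN0
    ((psi_isLocalHomeomorph N).apply_localInverseAt_of_mem hw)
  refine ⟨A, ?_⟩
  have hmem : A • w ∈ ((psi_isLocalHomeomorph N).localInverseAt u).target := by
    rw [hAw]
    exact ((psi_isLocalHomeomorph N).localInverseAt u).map_source hw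
  have hev : ∀ᶠ v in nhds w, A • v ∈ ((psi_isLocalHomeomorph N).localInverseAt u).target :=
    (continuous_const_smul A).continuousAt.eventually
      (((psi_isLocalHomeomorph N).localInverseAt u).open_target.mem_nhds hmem)
  filter_upwards [hev] with v hv
  have h1 := ((psi_isLocalHomeomorph N).localInverseAt u).right_inv hv
  rw [IsLocalHomeomorph.localInverseAt_symm, psi_gamma hN0 hA] at h1
  exact h1

theorem chart_apply (u v : ℍ × ℂ) :
    chartAt (ModelProd ℂ ℂ) u v = ((v.1 : ℂ), v.2) := rfl

theorem transition_contDiffAt {N : ℕ} [hN : Fact (2 < N)] (u u' : ℍ × ℂ) {z : ℂ × ℂ}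
    (hz : z ∈ ((((psi_isLocalHomeomorph N).localInverseAt u).trans
        (chartAt (ModelProd ℂ ℂ) u)).symm.trans
      (((psi_isLocalHomeomorph N).localInverseAt u').trans (chartAt (ModelProd ℂ ℂ) u'))).source) :
    ContDiffAt (E := ℂ × ℂ) (F := ℂ × ℂ) ℂ ω (fun z => ((((psi_isLocalHomeomorph N).localInverseAt u).trans
        (chartAt (ModelProd ℂ ℂ) u)).symm.trans
      (((psi_isLocalHomeomorph N).localInverseAt u').trans
        (chartAt (ModelProd ℂ ℂ) u'))) z) z := by
  have hsymm : ∀ v, ((psi_isLocalHomeomorph N).localInverseAt u).symm v = psi N v := fun v =>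
    congrFun ((psi_isLocalHomeomorph N).localInverseAt_symm (x := u)) v
  have hval : ∀ z : ℂ × ℂ, ((((psi_isLocalHomeomorph N).localInverseAt u).trans
        (chartAt (ModelProd ℂ ℂ) u)).symm.trans
      (((psi_isLocalHomeomorph N).localInverseAt u').trans
        (chartAt (ModelProd ℂ ℂ) u'))) z = chartAt (ModelProd ℂ ℂ) u'
          ((psi_isLocalHomeomorph N).localInverseAt u'
            (psi N ((chartAt (ModelProd ℂ ℂ) u).symm z))) := by
    intro z
    rw [← hsymm]
    rfl
  rw [OpenPartialHomeomorph.trans_source, OpenPartialHomeomorph.symm_source,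
    OpenPartialHomeomorph.trans_target, OpenPartialHomeomorph.trans_source] at hz
  obtain ⟨⟨hz1, hz2⟩, hz3, -⟩ := hz
  have hw : psi N ((chartAt (ModelProd ℂ ℂ) u).symm z) ∈
      ((psi_isLocalHomeomorph N).localInverseAt u').source := by
    rw [← hsymm]
    exact hz3
  obtain ⟨A, hA⟩ := psi_transition hw
  have hev := ((chartAt (ModelProd ℂ ℂ) u).continuousAt_symm hz1).eventually hA
  have hev2 := (chartAt (ModelProd ℂ ℂ) u).open_target.mem_nhds hz1
  have hform : ∀ z ∈ (chartAt (ModelProd ℂ ℂ) u).target,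
      ((((chartAt (ModelProd ℂ ℂ) u).symm z).1 : ℍ) : ℂ) = z.1 ∧
        ((chartAt (ModelProd ℂ ℂ) u).symm z).2 = z.2 := by
    intro z hz
    have := (chartAt (ModelProd ℂ ℂ) u).right_inv hz
    rw [chart_apply] at this
    exact ⟨congrArg Prod.fst this, congrArg Prod.snd this⟩
  have hne : (A 1 0 : ℂ) * z.1 + A 1 1 ≠ 0 := by
    rw [← (hform z hz1).1]
    exact denom_ne A _
  have hsm : ContDiffAt ℂ ω (fun z : ℂ × ℂ =>
      (((A 0 0 : ℂ) * z.1 + A 0 1) / ((A 1 0 : ℂ) * z.1 + A 1 1),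
        z.2 / ((A 1 0 : ℂ) * z.1 + A 1 1))) z := by
    refine ContDiffAt.prodMk (ContDiffAt.div ?_ ?_ hne) (ContDiffAt.div ?_ ?_ hne) <;> fun_prop
  refine hsm.congr_of_eventuallyEq ?_
  filter_upwards [hev, hev2] with y hy hy2
  rw [hval, hy, chart_apply, smul_HC, sl_coe_smul, (hform y hy2).1, (hform y hy2).2]

/-- For `N > 2` the space `T̃(N)` is a complex manifold. -/
instance (N : ℕ) [hN : Fact (2 < N)] : IsManifold (𝓘(ℂ).prod 𝓘(ℂ)) ω (OpenT N) := by
  refine isManifold_of_contDiffOn _ _ _ ?_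
  rintro e e' ⟨y, rfl⟩ ⟨y', rfl⟩ z ⟨hz, -⟩
  exact (transition_contDiffAt _ _ hz).contDiffWithinAt

/-- The model with corners of `ℍ × ℂ` and of `T̃(N)`. -/
abbrev model : ModelWithCorners ℂ (ℂ × ℂ) (ModelProd ℂ ℂ) := 𝓘(ℂ).prod 𝓘(ℂ)

/-- The action of `A` on the tangent space `𝒯_α` at a fixed point `α` of `A`, that is the
differential at `α` of the self-map `β ↦ A β` of `T̃(N)`, with its target `𝒯_{A α}`
identified with `𝒯_α` through `A α = α`. -/
def tangentAction {N : ℕ} [Fact (2 < N)] (A : SL(2, ℤ)) (α : OpenT N) (h : A • α = α) :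
    TangentSpace model α →L[ℂ] TangentSpace model α :=
  cast (congrArg (fun β => TangentSpace model α →L[ℂ] TangentSpace model β) h)
    (mfderiv model model (fun β : OpenT N => A • β) α)

end FramedCurve

end

namespace FramedCurve

/-! ### Differentiability of the uniformization and of its local inverses -/

/-! The map `psi N` is a covering with group `Γ(N)`, and it carries the linear fractional action on
`ℍ × ℂ` to the action on level structures. If `A` fixes `ψ(σ, t)`, then `A (σ, t)` and `(σ, t)` lie
in one `Γ(N)`-orbit, so `A (σ, t) = γ (σ, t)` for some `γ ∈ Γ(N)`, and `B = γ⁻¹ A = (a b; c d)`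
fixes `(σ, t)` itself. Everything is then read off from `B`.

Put `λ = cσ + d`. The second coordinate gives `t / λ = t`. Hence `t = 0` or `λ = 1`, and `λ = 1`
together with `Bσ = σ` forces `B = 1`, because `σ` and `1` are independent over `ℤ`
(`eq_zero_or_eq_one_of_smul_eq`). In the second case `A = γ ∈ Γ(N)`, which proves (i).

For (ii), `ψ` is invariant under `γ`, so near the fixed point the action of `A` is `ψ ∘ B ∘ ψ⁻¹` for
the local inverse of `ψ` at `(σ, t)`. The differential of `ψ` is an isomorphism
(`exists_hasMFDerivAt_psi`), so it conjugates the differential of `B` into that of `A`. The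
differential of `B` (`hasMFDerivAt_smul_HC`) is triangular with diagonal `λ⁻², λ⁻¹` and off-diagonal
entry `-c t / λ²`. This entry vanishes because `t = 0` or `B = 1`. -/

theorem mem_source_transition {N : ℕ} [Fact (2 < N)] {u u' w : ℍ × ℂ}
    (hu : w ∈ ((psi_isLocalHomeomorph N).localInverseAt u).target)
    (hu' : psi N w ∈ ((psi_isLocalHomeomorph N).localInverseAt u').source) :
    chartAt (ModelProd ℂ ℂ) u w ∈ ((((psi_isLocalHomeomorph N).localInverseAt u).trans
        (chartAt (ModelProd ℂ ℂ) u)).symm.trans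
      (((psi_isLocalHomeomorph N).localInverseAt u').trans
        (chartAt (ModelProd ℂ ℂ) u'))).source := by
  have hw : (chartAt (ModelProd ℂ ℂ) u).symm (chartAt (ModelProd ℂ ℂ) u w) = w :=
    (chartAt (ModelProd ℂ ℂ) u).left_inv ⟨trivial, trivial⟩
  rw [OpenPartialHomeomorph.trans_source, OpenPartialHomeomorph.symm_source,
    OpenPartialHomeomorph.trans_target, OpenPartialHomeomorph.trans_source]
  refine ⟨⟨(chartAt (ModelProd ℂ ℂ) u).map_source ⟨trivial, trivial⟩, ?_⟩, ?_, ⟨trivial, trivial⟩⟩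
  · rw [Set.mem_preimage, hw]
    exact hu
  · change ((psi_isLocalHomeomorph N).localInverseAt u).symm
      ((chartAt (ModelProd ℂ ℂ) u).symm (chartAt (ModelProd ℂ ℂ) u w)) ∈ _
    rw [hw, IsLocalHomeomorph.localInverseAt_symm]
    exact hu'

/-- The chart at `α` is built from a chosen preimage `g` of `α`. For `α = psi N u` this `g` may
differ from `u` by an element of `Γ(N)`, so in charts `ψ` is a coordinate change and not simply the
identity. -/
theorem exists_chartAt_eq (N : ℕ) [Fact (2 < N)] (α : OpenT N) :
    ∃ g : ℍ × ℂ, psi N g = α ∧ chartAt (ModelProd ℂ ℂ) α =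
      ((psi_isLocalHomeomorph N).localInverseAt g).trans (chartAt (ModelProd ℂ ℂ) g) :=
  ⟨_, (psi_surjective (by have := Fact.out (p := 2 < N); omega)).hasRightInverse.choose_spec α, rfl⟩

theorem psi_mdifferentiableAt (N : ℕ) [Fact (2 < N)] (u : ℍ × ℂ) :
    MDifferentiableAt model model (psi N) u := by
  rw [mdifferentiableAt_iff]
  refine ⟨(psi_isLocalHomeomorph N).continuous.continuousAt, ?_⟩
  obtain ⟨g, hgu, hg⟩ := exists_chartAt_eq N (psi N u)
  -- In charts `ψ` is the coordinate change from the local inverse at `u` to the one at `g`, which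
  -- is analytic.
  have h := transition_contDiffAt (N := N) u g (mem_source_transition (w := u)
    (IsLocalHomeomorph.self_mem_localInverseAt_target _)
    (hgu ▸ IsLocalHomeomorph.apply_self_mem_localInverseAt_source _))
  refine DifferentiableAt.differentiableWithinAt ((h.differentiableAt
    (by simp)).congr_of_eventuallyEq (Filter.Eventually.of_forall fun z => ?_))
  change chartAt (ModelProd ℂ ℂ) (psi N u) (psi N ((chartAt (ModelProd ℂ ℂ) u).symm z)) =
    (((psi_isLocalHomeomorph N).localInverseAt g).trans (chartAt (ModelProd ℂ ℂ) g))
      (((psi_isLocalHomeomorph N).localInverseAt u).symm ((chartAt (ModelProd ℂ ℂ) u).symm z))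
  rw [hg, IsLocalHomeomorph.localInverseAt_symm]

theorem localInverseAt_mdifferentiableAt (N : ℕ) [Fact (2 < N)] (u : ℍ × ℂ) :
    MDifferentiableAt model model ((psi_isLocalHomeomorph N).localInverseAt u) (psi N u) := by
  rw [mdifferentiableAt_iff]
  have hu := (psi_isLocalHomeomorph N).apply_self_mem_localInverseAt_source (x := u)
  refine ⟨((psi_isLocalHomeomorph N).localInverseAt u).continuousAt hu, ?_⟩
  obtain ⟨g, hgu, hg⟩ := exists_chartAt_eq N (psi N u)
  -- The same coordinate change in the opposite direction. Its base point is the coordinate of `g`,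
  -- not of `u`, as `hz` records.
  have h := transition_contDiffAt (N := N) g u (mem_source_transition (w := g)
    (IsLocalHomeomorph.self_mem_localInverseAt_target _) (hgu ▸ hu))
  have hz : extChartAt model (psi N u) (psi N u) = chartAt (ModelProd ℂ ℂ) g g := by
    change chartAt (ModelProd ℂ ℂ) (psi N u) (psi N u) = _
    rw [hg, ← hgu]
    exact congrArg (chartAt (ModelProd ℂ ℂ) g) (IsLocalHomeomorph.localInverseAt_apply_self _)
  rw [hz]
  refine DifferentiableAt.differentiableWithinAt ((h.differentiableAt
    (by simp)).congr_of_eventuallyEq (Filter.Eventually.of_forall fun z => ?_))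
  change chartAt (ModelProd ℂ ℂ) u ((psi_isLocalHomeomorph N).localInverseAt u
    ((chartAt (ModelProd ℂ ℂ) (psi N u)).symm z)) = _
  rw [hg]
  rfl

/-- The differential of `ψ` is an isomorphism; its inverse is the differential of a local
inverse of `ψ`. -/
theorem exists_hasMFDerivAt_psi (N : ℕ) [Fact (2 < N)] (u : ℍ × ℂ) :
    ∃ e : TangentSpace model u ≃L[ℂ] TangentSpace model (psi N u),
      HasMFDerivAt model model (psi N) u e.toContinuousLinearMap ∧
      HasMFDerivAt model model ((psi_isLocalHomeomorph N).localInverseAt u) (psi N u)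
        e.symm.toContinuousLinearMap := by
  have hu := (psi_isLocalHomeomorph N).apply_self_mem_localInverseAt_source (x := u)
  have hself := (psi_isLocalHomeomorph N).localInverseAt_apply_self (x := u)
  have h1 := (psi_mdifferentiableAt N u).hasMFDerivAt
  have h2 := (localInverseAt_mdifferentiableAt N u).hasMFDerivAt
  -- `h2` has its values in the tangent space at the image of `psi N u` under the local inverse. It
  -- is retyped here as the tangent space at `u`; both are `ℂ × ℂ` by definition.
  obtain ⟨D, hD⟩ : ∃ D : TangentSpace model (psi N u) →L[ℂ] TangentSpace model u,
    HasMFDerivAt model model ((psi_isLocalHomeomorph N).localInverseAt u) (psi N u) D := ⟨_, h2⟩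
  obtain ⟨P, hP⟩ : ∃ P : TangentSpace model u →L[ℂ] TangentSpace model (psi N u),
    HasMFDerivAt model model (psi N) u P := ⟨_, h1⟩
  -- Both composites agree near the base point with the identity, so the chain rule and uniqueness
  -- of the derivative make `D` and `P` mutually inverse.
  have hDP : D.comp P = ContinuousLinearMap.id ℂ (TangentSpace model u) := by
    refine hasMFDerivAt_unique (HasMFDerivAt.comp u hD hP) ?_
    refine (hasMFDerivAt_id u).congr_of_eventuallyEq ?_
    filter_upwards [((psi_isLocalHomeomorph N).localInverseAt u).open_target.mem_nhds
      (psi_isLocalHomeomorph N).self_mem_localInverseAt_target] with v hv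
    have := ((psi_isLocalHomeomorph N).localInverseAt u).right_inv hv
    rwa [IsLocalHomeomorph.localInverseAt_symm] at this
  have hPD : P.comp D = ContinuousLinearMap.id ℂ (TangentSpace model (psi N u)) := by
    refine hasMFDerivAt_unique (HasMFDerivAt.comp (psi N u) (hself.symm ▸ hP) hD) ?_
    refine (hasMFDerivAt_id (psi N u)).congr_of_eventuallyEq ?_
    filter_upwards [((psi_isLocalHomeomorph N).localInverseAt u).open_source.mem_nhds hu] with v hv
    exact (psi_isLocalHomeomorph N).apply_localInverseAt_of_mem hv
  exact ⟨ContinuousLinearEquiv.equivOfInverse P D (fun x => DFunLike.congr_fun hDP x)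
    (fun x => DFunLike.congr_fun hPD x), hP, hD⟩

/-! ### The differential of the linear fractional action on `ℍ × ℂ` -/

/-- The differential at `(τ, t)` of `(τ, t) ↦ ((a τ + b) / (c τ + d), t / (c τ + d))`. -/
theorem hasMFDerivAt_smul_HC (A : SL(2, ℤ)) (u : ℍ × ℂ) :
    ∃ D : TangentSpace model u →L[ℂ] TangentSpace model (A • u),
      HasMFDerivAt model model (fun v : ℍ × ℂ => A • v) u D ∧
      ∀ x s : ℂ, D (x, s) = (x / ((A 1 0 : ℂ) * u.1 + A 1 1) ^ 2,
        s / ((A 1 0 : ℂ) * u.1 + A 1 1) - A 1 0 * u.2 * x / ((A 1 0 : ℂ) * u.1 + A 1 1) ^ 2) := by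
  have hne := denom_ne A u.1
  have hdet : (A 0 0 : ℂ) * A 1 1 - A 0 1 * A 1 0 = 1 := by
    have := A.det_coe
    rw [Matrix.det_fin_two] at this
    exact_mod_cast this
  obtain ⟨l, hl⟩ : ∃ l, l = (A 1 0 : ℂ) * u.1 + A 1 1 := ⟨_, rfl⟩
  rw [← hl] at hne ⊢
  let fst := ContinuousLinearMap.fst ℂ ℂ ℂ
  let snd := ContinuousLinearMap.snd ℂ ℂ ℂ
  have h0 : HasFDerivAt (fun z : ℂ × ℂ => (A 0 0 : ℂ) * z.1 + A 0 1) ((A 0 0 : ℂ) • fst)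
      ((u.1 : ℂ), u.2) := (fst.hasFDerivAt.const_mul _).add_const _
  have h1 : HasFDerivAt (fun z : ℂ × ℂ => (A 1 0 : ℂ) * z.1 + A 1 1) ((A 1 0 : ℂ) • fst)
      ((u.1 : ℂ), u.2) := (fst.hasFDerivAt.const_mul _).add_const _
  have h2 : HasFDerivAt (fun z : ℂ × ℂ => z.2) snd ((u.1 : ℂ), u.2) := snd.hasFDerivAt
  have hne' : (A 1 0 : ℂ) * ((u.1 : ℂ), u.2).1 + A 1 1 ≠ 0 := hl ▸ hne
  have hinv := (hasDerivAt_inv hne').comp_hasFDerivAt ((u.1 : ℂ), u.2) h1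
  have h3 := (h0.mul hinv).prodMk (h2.mul hinv)
  refine ⟨_, ⟨(continuous_const_smul A).continuousAt, HasFDerivAt.hasFDerivWithinAt
    (h3.congr_of_eventuallyEq ?_)⟩, fun x s => ?_⟩
  -- The explicit formula describes the action only at coordinates of points of `ℍ × ℂ`; these form
  -- an open set, which suffices for the derivative.
  · filter_upwards [(chartAt (ModelProd ℂ ℂ) u).open_target.mem_nhds
      ((chartAt (ModelProd ℂ ℂ) u).map_source (x := u) ⟨trivial, trivial⟩)] with z hz
    have hr := (chartAt (ModelProd ℂ ℂ) u).right_inv hz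
    rw [chart_apply] at hr
    change chartAt (ModelProd ℂ ℂ) (A • u) (A • (chartAt (ModelProd ℂ ℂ) u).symm z) = _
    rw [chart_apply, smul_HC, sl_coe_smul]
    rw [show (((chartAt (ModelProd ℂ ℂ) u).symm z).1 : ℂ) = z.1 from congrArg Prod.fst hr,
      show ((chartAt (ModelProd ℂ ℂ) u).symm z).2 = z.2 from congrArg Prod.snd hr]
    rw [div_eq_mul_inv, div_eq_mul_inv]
    rfl
  · refine Prod.ext ?_ ?_
    · change ((A 0 0 : ℂ) * u.1 + A 0 1) * (-(((A 1 0 : ℂ) * u.1 + A 1 1) ^ 2)⁻¹ * (A 1 0 * x)) +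
        ((A 1 0 : ℂ) * u.1 + A 1 1)⁻¹ * (A 0 0 * x) = x / l ^ 2
      rw [← hl]
      field_simp
      -- The numerator is `a (cτ + d) - c (aτ + b) = ad - bc = 1`.
      linear_combination x * A 0 0 * hl + x * hdet
    · change u.2 * (-(((A 1 0 : ℂ) * u.1 + A 1 1) ^ 2)⁻¹ * (A 1 0 * x)) +
        ((A 1 0 : ℂ) * u.1 + A 1 1)⁻¹ * s = s / l - A 1 0 * u.2 * x / l ^ 2
      rw [← hl]
      field_simp
      ring

/-! ### Stabilizers: the induced automorphism of `E_σ` and the case `t ≠ 0` -/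

/-- Multiplication by `c σ + d` is an automorphism of `E_σ` if `(a b; c d)` fixes `σ`. -/
theorem exists_automorphism {B : SL(2, ℤ)} {σ : ℍ} (h : B • σ = σ) :
    ∃ f : EllCurve σ ≃ₜ+ EllCurve σ, ∀ z : ℂ,
      f (QuotientAddGroup.mk z) =
        QuotientAddGroup.mk (((B 1 0 : ℂ) * (σ : ℂ) + (B 1 1 : ℂ)) * z) := by
  have hμ := denom_ne B σ
  have hτ := sl_coe_smul B σ
  rw [h, eq_div_iff hμ] at hτ
  obtain ⟨l, hl⟩ : ∃ l, l = (B 1 0 : ℂ) * σ + B 1 1 := ⟨_, rfl⟩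
  rw [← hl] at hμ hτ ⊢
  obtain ⟨f, hf⟩ := exists_torusEquiv (Λ := tauLattice σ) (Λ' := tauLattice σ) l hμ (by
    intro z
    -- Since `l σ = a σ + b` and `l = c σ + d`, multiplication by `l` takes the basis `(σ, 1)` to
    -- another basis of the same lattice.
    rw [tauLattice, ← periodLattice_sl B σ 1 (l * z), mem_periodLattice, mem_periodLattice]
    refine exists_congr fun m => exists_congr fun n => ?_
    rw [mul_one, mul_one, ← hτ, mul_one, ← hl, ← mul_right_inj' hμ]
    ring_nf)
  have hf' : ∀ z : ℂ, f.symm (QuotientAddGroup.mk z) = QuotientAddGroup.mk (l⁻¹ * z) := fun z => by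
    rw [AddEquiv.symm_apply_eq, hf, mul_inv_cancel_left₀ hμ]
  have hcont : ∀ (g : EllCurve σ → EllCurve σ) (m : ℂ),
      (∀ z : ℂ, g (QuotientAddGroup.mk z) = QuotientAddGroup.mk (m * z)) → Continuous g := by
    intro g m hg
    refine (QuotientAddGroup.isQuotientMap_mk (N := tauLattice σ)).continuous_iff.2 ?_
    rw [show g ∘ QuotientAddGroup.mk = fun z : ℂ => QuotientAddGroup.mk (m * z) from funext hg]
    exact QuotientAddGroup.continuous_mk.comp (continuous_const.mul continuous_id)
  exact ⟨{ f with
    continuous_toFun := hcont f l hf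
    continuous_invFun := hcont f.symm l⁻¹ hf' }, hf⟩

/-- If `B` fixes `(σ, t)`, then `t = 0` or `B = 1`. -/
theorem eq_zero_or_eq_one_of_smul_eq {B : SL(2, ℤ)} {σ : ℍ} {t : ℂ} (h : B • (σ, t) = (σ, t)) :
    t = 0 ∨ B = 1 := by
  refine or_iff_not_imp_left.2 fun ht => ?_
  have h1 : B • σ = σ := congrArg Prod.fst h
  have h2 : t / ((B 1 0 : ℂ) * σ + B 1 1) = t := congrArg Prod.snd h
  have hne := denom_ne B σ
  -- For `t ≠ 0` the fibre coordinate gives `cσ + d = 1`, and then `Bσ = σ` reads `aσ + b = σ`.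
  -- Comparing coefficients of `σ` and `1` determines all four entries.
  have hl : (B 1 0 : ℂ) * σ + B 1 1 = ((0 : ℤ) : ℂ) * σ + ((1 : ℤ) : ℂ) := by
    rw [div_eq_iff hne] at h2
    push_cast
    rw [zero_mul, zero_add]
    exact mul_left_cancel₀ ht (by rw [← h2, mul_one])
  have hτ := sl_coe_smul B σ
  rw [h1, hl] at hτ
  have hτ' : (B 0 0 : ℂ) * σ + B 0 1 = ((1 : ℤ) : ℂ) * σ + ((0 : ℤ) : ℂ) := by
    simpa using hτ.symm
  obtain ⟨hc, hd⟩ := tau_indep hl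
  obtain ⟨ha, hb⟩ := tau_indep hτ'
  ext i j
  fin_cases i <;> fin_cases j
  exacts [ha, hb, hc, hd]

end FramedCurve

/-! ### The action at a fixed point -/

theorem mainTheorem4 (N : ℕ) [Fact (2 < N)] (σ : ℍ) (t : ℂ) (A : SL(2, ℤ))
    (hA : A • FramedCurve.psi N (σ, t) = FramedCurve.psi N (σ, t)) :
    (A ∉ CongruenceSubgroup.Gamma N →
      t = 0 ∧ FramedCurve.psi N (σ, t) ∈ FramedCurve.zeroSection N) ∧
    ∃ γ ∈ CongruenceSubgroup.Gamma N, (γ⁻¹ * A) • σ = σ ∧ (A • σ = σ → γ = 1) ∧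
      ∃ lam : ℂ, lam = ((γ⁻¹ * A) 1 0 : ℂ) * (σ : ℂ) + ((γ⁻¹ * A) 1 1 : ℂ) ∧
        (∃ f : FramedCurve.EllCurve σ ≃ₜ+ FramedCurve.EllCurve σ,
          ∀ z : ℂ, f (QuotientAddGroup.mk z) = QuotientAddGroup.mk (lam * z)) ∧
        MDifferentiableAt FramedCurve.model FramedCurve.model
          (fun β : FramedCurve.OpenT N => A • β) (FramedCurve.psi N (σ, t)) ∧
        ∃ e : TangentSpace FramedCurve.model (σ, t) ≃L[ℂ]
            TangentSpace FramedCurve.model (FramedCurve.psi N (σ, t)),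
          HasMFDerivAt FramedCurve.model FramedCurve.model (FramedCurve.psi N) (σ, t)
            e.toContinuousLinearMap ∧
          ∀ x s : ℂ,
            FramedCurve.tangentAction A (FramedCurve.psi N (σ, t)) hA (e (x, s)) =
              e (x / lam ^ 2, s / lam) := by
  have hN : 2 < N := Fact.out
  have hN0 : N ≠ 0 := by omega
  obtain ⟨γ, hγ, hγA⟩ := FramedCurve.psi_eq hN0 ((FramedCurve.smul_psi N A (σ, t)).symm.trans hA)
  obtain ⟨B, hB⟩ : ∃ B, B = γ⁻¹ * A := ⟨_, rfl⟩
  have hAB : A = γ * B := by rw [hB, mul_inv_cancel_left]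
  have hfix : B • (σ, t) = (σ, t) := by rw [hB, mul_smul, ← hγA, inv_smul_smul]
  have hσ : B • σ = σ := congrArg Prod.fst hfix
  have htB := FramedCurve.eq_zero_or_eq_one_of_smul_eq hfix
  -- This kills the off-diagonal entry of the differential of `B`: either `t = 0`, or `B = 1` and
  -- then `c = 0`.
  have hct : (B 1 0 : ℂ) * t = 0 := by
    rcases htB with h | h <;> simp [h]
  refine ⟨fun hAΓ => ?_, γ, hγ, hB ▸ hσ, fun h => ?_, _, rfl, ?_⟩
  · have ht : t = 0 := htB.resolve_right fun h => hAΓ (by rwa [hAB, h, mul_one])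
    exact ⟨ht, FramedCurve.psiDatum N (σ, t), ht, rfl⟩
  -- If `Aσ = σ`, then `γσ = γ(Bσ) = Aσ = σ`, and `Γ(N)` acts freely on `ℍ`.
  · refine FramedCurve.gamma_free hN hγ (τ := σ) ?_
    rwa [hAB, mul_smul, hσ] at h
  rw [← hB]
  obtain ⟨e, he, he'⟩ := FramedCurve.exists_hasMFDerivAt_psi N (σ, t)
  obtain ⟨D, hD, hDapp⟩ := FramedCurve.hasMFDerivAt_smul_HC B (σ, t)
  have hself := (FramedCurve.psi_isLocalHomeomorph N).localInverseAt_apply_self (x := (σ, t))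
  have hcomp : HasMFDerivAt FramedCurve.model FramedCurve.model
      (fun β : FramedCurve.OpenT N => A • β) (FramedCurve.psi N (σ, t))
      (e.toContinuousLinearMap ∘L D ∘L e.symm.toContinuousLinearMap) := by
    refine (HasMFDerivAt.comp (FramedCurve.psi N (σ, t)) (g := FramedCurve.psi N)
      (f := fun β => B • (FramedCurve.psi_isLocalHomeomorph N).localInverseAt (σ, t) β)
      (by rw [hself, hfix]; exact he)
      (HasMFDerivAt.comp (FramedCurve.psi N (σ, t)) (g := fun v : ℍ × ℂ => B • v)
        (hself.symm ▸ hD) he')).congr_of_eventuallyEq ?_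
    filter_upwards [((FramedCurve.psi_isLocalHomeomorph N).localInverseAt
      (σ, t)).open_source.mem_nhds
        (FramedCurve.psi_isLocalHomeomorph N).apply_self_mem_localInverseAt_source] with β hβ
    -- With `v` the local inverse image of `β`: `ψ(Bv) = ψ(γBv) = ψ(Av) = A ψ(v) = A β`.
    rw [Function.comp_apply, ← FramedCurve.psi_gamma hN0 hγ, ← mul_smul, ← hAB,
      ← FramedCurve.smul_psi, IsLocalHomeomorph.apply_localInverseAt_of_mem _ hβ]
  refine ⟨FramedCurve.exists_automorphism hσ, hcomp.mdifferentiableAt, e, he, fun x s => ?_⟩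
  -- The cast in `tangentAction` is between definitionally equal types, since the tangent space at
  -- every point is the model space.
  have hact : FramedCurve.tangentAction A (FramedCurve.psi N (σ, t)) hA =
      mfderiv FramedCurve.model FramedCurve.model
        (fun β : FramedCurve.OpenT N => A • β) (FramedCurve.psi N (σ, t)) := rfl
  rw [hact, hcomp.mfderiv]
  have hD' : D (x, s) = (x / ((B 1 0 : ℂ) * σ + B 1 1) ^ 2, s / ((B 1 0 : ℂ) * σ + B 1 1)) := by
    refine (hDapp x s).trans ?_
    dsimp only
    rw [hct, zero_mul, zero_div, sub_zero]
  exact congrArg e ((congrArg D (e.symm_apply_apply (x, s))).trans hD')
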